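/- Let $F=\mathbb C((t))$, $A=\mathbb C[[t]]$, $G=SL_3(\mathbb C)$, let $B\subset G$ be the Borel subgroup of upper triangular matrices, $T\subset B$ the diagonal torus, $N$ its normalizer, and $\mathfrak b_u$ the space of strictly upper triangular complex $3\times 3$ matrices. Let $\mathcal G=SL_3(F)$ and let $\mathcal B\subset SL_3(A)\subset\mathcal G$ be the preimage of $B$ under $SL_3(A)\to G$, $t\mapsto 0$. Let $\widehat W=N(\mathbb C[t,t^{-1}])/T$ be the affine Weyl group, with Coxeter generators $s_0,s_1,s_2$ represented by $$\begin{pmatrix}0&0&t^{-1}\\0&1&0\\-t&0&0\end{pmatrix},\quad \begin{pmatrix}0&1&0\\-1&0&0\\0&0&1\end{pmatrix},\quad \begin{pmatrix}1&0&0\\0&0&1\\0&-1&0\end{pmatrix},$$ Coxeter length $\ell$ and Bruhat order $\le$. For $w\in\widehat W$ let $X(w)=\bigcup_{\tau\le w}\mathcal B\tau\mathcal B\ (\mathrm{mod}\ \mathcal B)\subset\mathcal G/\mathcal B$ be the affine Schubert variety. Let $T^*G/B=G\times^B\mathfrak b_u$ be the quotient of $G\times\mathfrak b_u$ by the relation $(g,Y)\sim(gb,b^{-1}Yb)$,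 $b\in B$. For a polynomial $p$ in one variable with coefficients in $F$ and constant term $1$, let $$\psi_p:T^*G/B\to\mathcal G/\mathcal B,\qquad \psi_p(g,Y)=g\,p(Y)\ (\mathrm{mod}\ \mathcal B).$$ Then for every such $p$: (1) If $\psi_p$ is injective, then there exist $g\in G$, $w\in\widehat W$ and $Y\in\mathfrak b_u$ such that $\psi_p(g,Y)\in\mathcal Bw\mathcal B\ (\mathrm{mod}\ \mathcal B)$ and $\ell(w)>6$. (2) $\psi_p$ does not realize any affine Schubert variety as a compactification of $T^*G/B$: there is no $w\in\widehat W$ such that $\psi_p$ is injective and the closure of its image, in the Zariski topology of the ind-variety $\mathcal G/\mathcal B$, is $X(w)$. -/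

import Mathlib

noncomputable section

namespace AffineFlagSL3

open Matrix

/-- The field `F = ℂ((t))`. -/
abbrev F : Type := LaurentSeries ℂ

/-- The ring `A = ℂ[[t]]`. -/
abbrev A : Type := PowerSeries ℂ

/-- The ring `ℂ[t, t⁻¹]`. -/
abbrev R : Type := LaurentPolynomial ℂ

/-- `G = SL₃(ℂ)`. -/
abbrev G : Type := SpecialLinearGroup (Fin 3) ℂ

/-- `𝒢 = G(F) = SL₃(ℂ((t)))`. -/
abbrev LoopG : Type := SpecialLinearGroup (Fin 3) F

/-- The inclusion `ℂ → ℂ((t))` as constant series. -/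
def constF : ℂ →+* F := HahnSeries.C

/-- The inclusion `G → 𝒢` as constant loops. -/
def constLoop : G →* LoopG := SpecialLinearGroup.map constF

/-- The Borel subgroup `B ⊆ G` of upper triangular matrices. -/
def borel : Subgroup G where
  carrier := {g | ∀ i j : Fin 3, j < i → (g : Matrix (Fin 3) (Fin 3) ℂ) i j = 0}
  one_mem' := by
    intro i j h
    exact Matrix.one_apply_ne h.ne'
  mul_mem' := by
    intro a b ha hb i j h
    change ((a : Matrix (Fin 3) (Fin 3) ℂ) * (b : Matrix (Fin 3) (Fin 3) ℂ)) i j = 0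
    rw [Matrix.mul_apply]
    refine Finset.sum_eq_zero fun k _ => ?_
    rcases lt_or_ge k i with hk | hk
    · rw [ha i k hk, zero_mul]
    · rw [hb k j (lt_of_lt_of_le h hk), mul_zero]
  inv_mem' := by
    intro a ha i j h
    have h10 := ha 1 0 (by decide)
    have h20 := ha 2 0 (by decide)
    have h21 := ha 2 1 (by decide)
    change adjugate (a : Matrix (Fin 3) (Fin 3) ℂ) i j = 0
    rw [adjugate_fin_three]
    fin_cases i <;> fin_cases j <;> simp_all

/-- The maximal torus `T ⊆ G` of diagonal matrices. -/
def torus : Subgroup G where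
  carrier := {g | ∀ i j : Fin 3, i ≠ j → (g : Matrix (Fin 3) (Fin 3) ℂ) i j = 0}
  one_mem' := by
    intro i j h
    exact Matrix.one_apply_ne h
  mul_mem' := by
    intro a b ha hb i j h
    change ((a : Matrix (Fin 3) (Fin 3) ℂ) * (b : Matrix (Fin 3) (Fin 3) ℂ)) i j = 0
    rw [Matrix.mul_apply]
    refine Finset.sum_eq_zero fun k _ => ?_
    by_cases hk : i = k
    · rw [hb k j (hk ▸ h), mul_zero]
    · rw [ha i k hk, zero_mul]
  inv_mem' := by
    intro a ha i j h
    have h01 := ha 0 1 (by decide)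
    have h02 := ha 0 2 (by decide)
    have h10 := ha 1 0 (by decide)
    have h12 := ha 1 2 (by decide)
    have h20 := ha 2 0 (by decide)
    have h21 := ha 2 1 (by decide)
    change adjugate (a : Matrix (Fin 3) (Fin 3) ℂ) i j = 0
    rw [adjugate_fin_three]
    fin_cases i <;> fin_cases j <;> simp_all

/-- The subgroup `𝓑 = π⁻¹(B)` of `𝒢`, where `π : G(A) → G` is the reduction `t ↦ 0` and
`G(A)` is regarded as a subgroup of `𝒢`. -/
def iwahori : Subgroup LoopG :=
  (borel.comap (SpecialLinearGroup.map (n := Fin 3) (PowerSeries.constantCoeff (R := ℂ)))).map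
    (SpecialLinearGroup.map (algebraMap A F))

/-! ### The affine Weyl group -/

/-- `T`, regarded as a subgroup of `SL₃(ℂ[t, t⁻¹])`. -/
def constTorus : Subgroup (SpecialLinearGroup (Fin 3) R) :=
  torus.map (SpecialLinearGroup.map (LaurentPolynomial.C (R := ℂ)))

/-- `N(ℂ[t, t⁻¹])`, for `N` the normalizer of `T` in `G`: since the constant diagonal matrices
are Zariski dense in the diagonal torus, it consists of the elements of `SL₃(ℂ[t, t⁻¹])` that
normalize the subgroup `T`. -/
def normT : Subgroup (SpecialLinearGroup (Fin 3) R) :=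
  Subgroup.normalizer (constTorus : Set (SpecialLinearGroup (Fin 3) R))

instance : (constTorus.subgroupOf normT).Normal :=
  Subgroup.normal_in_normalizer

/-- The affine Weyl group `Ŵ = N(ℂ[t, t⁻¹]) / T`. -/
abbrev AffineWeyl : Type := normT ⧸ constTorus.subgroupOf normT

theorem mem_normT {n : SpecialLinearGroup (Fin 3) R}
    (h : ∀ t ∈ constTorus, ∃ t' ∈ constTorus, n * t = t' * n ∧ t * n = n * t') : n ∈ normT := by
  rw [normT, Subgroup.mem_normalizer_iff]
  intro x
  constructor
  · intro hx
    obtain ⟨t', ht', h1, -⟩ := h x hx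
    rw [h1, mul_inv_cancel_right]
    exact ht'
  · intro hx
    obtain ⟨t', ht', -, h2⟩ := h _ hx
    have : x = t' := by
      rw [inv_mul_cancel_right] at h2
      exact mul_left_cancel h2
    exact this ▸ ht'

theorem mem_constTorus_perm {t : SpecialLinearGroup (Fin 3) R} (ht : t ∈ constTorus)
    (σ : Equiv.Perm (Fin 3)) :
    ∃ t' ∈ constTorus,
      (t' : Matrix (Fin 3) (Fin 3) R) = (t : Matrix (Fin 3) (Fin 3) R).submatrix σ σ := by
  obtain ⟨g, hg, rfl⟩ := ht
  refine ⟨_, ⟨⟨(g : Matrix (Fin 3) (Fin 3) ℂ).submatrix σ σ, ?_⟩, ?_, rfl⟩, ?_⟩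
  · rw [Matrix.det_submatrix_equiv_self, g.2]
  · intro i j hij
    exact hg _ _ fun h => hij (σ.injective h)
  · rfl

theorem constTorus_apply {t : SpecialLinearGroup (Fin 3) R} (ht : t ∈ constTorus)
    {i j : Fin 3} (h : i ≠ j) : (t : Matrix (Fin 3) (Fin 3) R) i j = 0 := by
  obtain ⟨g, hg, rfl⟩ := ht
  change LaurentPolynomial.C ((g : Matrix (Fin 3) (Fin 3) ℂ) i j) = 0
  rw [hg i j h, map_zero]

/-- The matrix lifts of the simple reflections `s₀, s₁, s₂` of `Ŵ`. -/
def simpleLiftMatrix : Fin 3 → Matrix (Fin 3) (Fin 3) R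
  | 0 => !![0, 0, LaurentPolynomial.T (-1); 0, 1, 0; -LaurentPolynomial.T 1, 0, 0]
  | 1 => !![0, 1, 0; -1, 0, 0; 0, 0, 1]
  | 2 => !![1, 0, 0; 0, 0, 1; 0, -1, 0]

theorem det_simpleLiftMatrix (i : Fin 3) : (simpleLiftMatrix i).det = 1 := by
  have hT : (LaurentPolynomial.T (-1) : R) * LaurentPolynomial.T 1 = 1 := by
    rw [← LaurentPolynomial.T_add, neg_add_cancel, LaurentPolynomial.T_zero]
  fin_cases i
  · change (!![0, 0, LaurentPolynomial.T (-1); 0, 1, 0; -LaurentPolynomial.T 1, 0, 0] :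
      Matrix (Fin 3) (Fin 3) R).det = 1
    generalize (LaurentPolynomial.T (-1) : R) = u at *
    generalize (LaurentPolynomial.T 1 : R) = v at *
    simp [Matrix.det_fin_three, hT]
  · simp [simpleLiftMatrix, Matrix.det_fin_three]
  · simp [simpleLiftMatrix, Matrix.det_fin_three]

def simpleLift (i : Fin 3) : SpecialLinearGroup (Fin 3) R :=
  ⟨simpleLiftMatrix i, det_simpleLiftMatrix i⟩

theorem simpleLift_mem (i : Fin 3) : simpleLift i ∈ normT := by
  refine mem_normT fun t ht => ?_
  have key : ∀ σ : Equiv.Perm (Fin 3),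
      (simpleLiftMatrix i * (t : Matrix (Fin 3) (Fin 3) R) =
          (t : Matrix (Fin 3) (Fin 3) R).submatrix σ σ * simpleLiftMatrix i) →
      ((t : Matrix (Fin 3) (Fin 3) R) * simpleLiftMatrix i =
          simpleLiftMatrix i * (t : Matrix (Fin 3) (Fin 3) R).submatrix σ σ) →
      ∃ t' ∈ constTorus, simpleLift i * t = t' * simpleLift i ∧
        t * simpleLift i = simpleLift i * t' := by
    intro σ h1 h2
    obtain ⟨t', ht', e⟩ := mem_constTorus_perm ht σ
    refine ⟨t', ht', Subtype.ext ?_, Subtype.ext ?_⟩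
    · change simpleLiftMatrix i * (t : Matrix (Fin 3) (Fin 3) R) =
        (t' : Matrix (Fin 3) (Fin 3) R) * simpleLiftMatrix i
      rw [e]
      exact h1
    · change (t : Matrix (Fin 3) (Fin 3) R) * simpleLiftMatrix i =
        simpleLiftMatrix i * (t' : Matrix (Fin 3) (Fin 3) R)
      rw [e]
      exact h2
  have et : (t : Matrix (Fin 3) (Fin 3) R) = Matrix.diagonal (fun i => t.1 i i) := by
    ext a b : 1
    by_cases hab : a = b
    · rw [hab, Matrix.diagonal_apply_eq]
    · rw [constTorus_apply ht hab, Matrix.diagonal_apply_ne _ hab]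
  rw [et] at key
  generalize (fun i => t.1 i i) = d at key
  fin_cases i
  · have e0 : simpleLiftMatrix (⟨0, by decide⟩ : Fin 3) =
        !![0, 0, LaurentPolynomial.T (-1); 0, 1, 0; -LaurentPolynomial.T 1, 0, 0] := rfl
    simp only [e0] at key
    generalize (LaurentPolynomial.T (-1) : R) = u at key
    generalize (LaurentPolynomial.T 1 : R) = v at key
    refine key (Equiv.swap 0 2) ?_ ?_ <;> ext a b : 1 <;>
      fin_cases a <;> fin_cases b <;>
      simp [Matrix.diagonal_mul, Matrix.mul_diagonal, Equiv.swap_apply_def, mul_comm]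
  · refine key (Equiv.swap 0 1) ?_ ?_ <;> ext a b : 1 <;>
      fin_cases a <;> fin_cases b <;>
      simp [simpleLiftMatrix, Matrix.diagonal_mul, Matrix.mul_diagonal, Equiv.swap_apply_def]
  · refine key (Equiv.swap 1 2) ?_ ?_ <;> ext a b : 1 <;>
      fin_cases a <;> fin_cases b <;>
      simp [simpleLiftMatrix, Matrix.diagonal_mul, Matrix.mul_diagonal, Equiv.swap_apply_def]

/-- The Coxeter generators `s₀, s₁, s₂` of `Ŵ`. -/
def simpleRefl (i : Fin 3) : AffineWeyl :=
  QuotientGroup.mk (⟨simpleLift i, simpleLift_mem i⟩ : normT)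

/-- The Coxeter length on `Ŵ`: the least length of a word in `s₀, s₁, s₂` with product `w`. -/
def length (w : AffineWeyl) : ℕ :=
  sInf {k | ∃ ω : List (Fin 3), ω.length = k ∧ (ω.map simpleRefl).prod = w}

/-- The reflections of `Ŵ`, i.e. the conjugates of the Coxeter generators. -/
def IsReflection (r : AffineWeyl) : Prop :=
  ∃ (x : AffineWeyl) (i : Fin 3), r = x * simpleRefl i * x⁻¹

/-- The Bruhat order `τ ≤ w` on `Ŵ`: `w` is obtained from `τ` by a chain of right
multiplications by reflections, each of which increases the length. -/
def BruhatLE (τ w : AffineWeyl) : Prop :=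
  Relation.ReflTransGen
    (fun u v => ∃ r, IsReflection r ∧ v = u * r ∧ length u < length v) τ w

/-! ### Bruhat cells and Schubert varieties in the affine flag variety -/

theorem single_one_ne_zero : (HahnSeries.single (1 : ℤ) (1 : ℂ) : F) ≠ 0 := by simp

/-- The inclusion `ℂ[t, t⁻¹] → ℂ((t))`. -/
def polyToSeries : R →+* F :=
  LaurentPolynomial.eval₂ constF
    (Units.mk0 (HahnSeries.single (1 : ℤ) (1 : ℂ)) single_one_ne_zero)

/-- The Bruhat cell `𝓑 w 𝓑 ⊆ 𝒢`, formed with a lift of `w` to `N(ℂ[t, t⁻¹])` (any two lifts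
differ by an element of `T ⊆ 𝓑`). -/
def bruhatCell (w : AffineWeyl) : Set LoopG :=
  {x | ∃ n : normT, (QuotientGroup.mk n : AffineWeyl) = w ∧
    ∃ b ∈ iwahori, ∃ b' ∈ iwahori,
      x = b * SpecialLinearGroup.map polyToSeries (n : SpecialLinearGroup (Fin 3) R) * b'}

/-- The affine flag variety `𝒢/𝓑`. -/
def AffineFlag : Type := LoopG ⧸ iwahori

def toFlag (x : LoopG) : AffineFlag := (QuotientGroup.mk x : LoopG ⧸ iwahori)

/-- The affine Schubert variety `X(w) = ⋃_{τ ≤ w} 𝓑 τ 𝓑 (mod 𝓑)`. -/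
def schubert (w : AffineWeyl) : Set AffineFlag :=
  ⋃ τ ∈ {τ | BruhatLE τ w}, toFlag '' bruhatCell τ

/-- The coordinates `(i, j, k) ↦` coefficient of `t ^ k` in the entry `x i j`. -/
def coords (x : LoopG) : Fin 3 × Fin 3 × ℤ → ℂ :=
  fun c => ((x : Matrix (Fin 3) (Fin 3) F) c.1 c.2.1).coeff c.2.2

/-- Closed sets of the (ind-)Zariski topology of `𝒢/𝓑`. The ind-scheme `𝒢` is the increasing
union of its subschemes of matrices all of whose entries lie in `t⁻ᴺ A`, and a subset of `𝒢/𝓑` is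
closed if its preimage in each of these is the zero set of a family of polynomials in the
coefficients of the Laurent series that are the entries of a matrix. -/
def IsZariskiClosed (S : Set AffineFlag) : Prop :=
  ∀ N : ℕ, ∃ I : Set (MvPolynomial (Fin 3 × Fin 3 × ℤ) ℂ),
    ∀ x : LoopG, (∀ i j, ∀ k < -(N : ℤ), coords x (i, j, k) = 0) →
      (toFlag x ∈ S ↔ ∀ f ∈ I, MvPolynomial.eval (coords x) f = 0)

instance : TopologicalSpace AffineFlag :=
  TopologicalSpace.ofClosed {S | IsZariskiClosed S}
    (by
      intro N
      exact ⟨{1}, fun x _ => by simp⟩)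
    (by
      intro 𝒮 h N
      choose I hI using fun (S : 𝒮) => h S.2 N
      refine ⟨⋃ S, I S, fun x hx => ?_⟩
      simp only [Set.mem_sInter, Set.mem_iUnion, forall_exists_index]
      constructor
      · intro hS f S hf
        exact (hI S x hx).1 (hS S S.2) f hf
      · intro hf S hS
        exact (hI ⟨S, hS⟩ x hx).2 fun f hf' => hf f ⟨S, hS⟩ hf')
    (by
      intro S hS S' hS' N
      obtain ⟨I, hI⟩ := hS N
      obtain ⟨I', hI'⟩ := hS' N
      refine ⟨{f | ∃ a ∈ I, ∃ b ∈ I', f = a * b}, fun x hx => ?_⟩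
      rw [Set.mem_union, hI x hx, hI' x hx]
      constructor
      · rintro (h | h) _ ⟨a, ha, b, hb, rfl⟩
        · rw [map_mul, h a ha, zero_mul]
        · rw [map_mul, h b hb, mul_zero]
      · intro h
        by_contra! hc
        obtain ⟨⟨a, ha, ha0⟩, ⟨b, hb, hb0⟩⟩ := hc
        have := h _ ⟨a, ha, b, hb, rfl⟩
        rw [map_mul] at this
        exact (mul_ne_zero ha0 hb0) this)

/-! ### The cotangent bundle and the maps `ψ_p` -/

/-- The Lie algebra `𝔟_u` of the unipotent radical of `B`: strictly upper triangular matrices. -/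
def nilradical : Submodule ℂ (Matrix (Fin 3) (Fin 3) ℂ) where
  carrier := {Y | ∀ i j : Fin 3, j ≤ i → Y i j = 0}
  zero_mem' := by
    intro i j _
    rfl
  add_mem' := by
    intro a b ha hb i j h
    simp [ha i j h, hb i j h]
  smul_mem' := by
    intro c a ha i j h
    simp [ha i j h]

/-- The relation `(g, Y) ∼ (g b, b⁻¹ Y b)`, `b ∈ B`, on `G × 𝔟_u`. -/
def cotangentSetoid : Setoid (G × nilradical) where
  r x y := ∃ b ∈ borel, y.1 = x.1 * b ∧
    (y.2 : Matrix (Fin 3) (Fin 3) ℂ) =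
      ((b⁻¹ : G) : Matrix (Fin 3) (Fin 3) ℂ) * (x.2 : Matrix (Fin 3) (Fin 3) ℂ) *
        (b : Matrix (Fin 3) (Fin 3) ℂ)
  iseqv :=
    { refl := fun x => ⟨1, one_mem _, by simp, by simp⟩
      symm := by
        rintro x y ⟨b, hb, h1, h2⟩
        refine ⟨b⁻¹, inv_mem hb, by simp [h1], ?_⟩
        have e : (b : Matrix (Fin 3) (Fin 3) ℂ) * ((b⁻¹ : G) : Matrix (Fin 3) (Fin 3) ℂ) = 1 :=
          congrArg Subtype.val (mul_inv_cancel b)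
        rw [h2, inv_inv]
        simp only [Matrix.mul_assoc, e, Matrix.mul_one]
        rw [← Matrix.mul_assoc, e, Matrix.one_mul]
      trans := by
        rintro x y z ⟨b, hb, h1, h2⟩ ⟨c, hc, h3, h4⟩
        refine ⟨b * c, mul_mem hb hc, by rw [h3, h1, mul_assoc], ?_⟩
        have e : (((b * c)⁻¹ : G) : Matrix (Fin 3) (Fin 3) ℂ) =
            ((c⁻¹ : G) : Matrix (Fin 3) (Fin 3) ℂ) * ((b⁻¹ : G) : Matrix (Fin 3) (Fin 3) ℂ) :=
          congrArg Subtype.val (_root_.mul_inv_rev b c)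
        have e' : ((b * c : G) : Matrix (Fin 3) (Fin 3) ℂ) =
            (b : Matrix (Fin 3) (Fin 3) ℂ) * (c : Matrix (Fin 3) (Fin 3) ℂ) := rfl
        rw [h4, h2, e, e']
        simp only [Matrix.mul_assoc] }

/-- The cotangent bundle `T^*G/B = G ×^B 𝔟_u`. -/
def Cotangent : Type := Quotient cotangentSetoid

/-- The point of `T^*G/B` represented by `(g, Y)`. -/
def Cotangent.mk (g : G) (Y : nilradical) : Cotangent := Quotient.mk cotangentSetoid (g, Y)

/-- The matrix `p(Y)`, for `p` a polynomial with coefficients in `F = ℂ((t))`. -/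
def evalMatrix (p : Polynomial F) (Y : Matrix (Fin 3) (Fin 3) ℂ) : Matrix (Fin 3) (Fin 3) F :=
  Polynomial.aeval (Y.map constF) p

theorem pow_upper (Y : Matrix (Fin 3) (Fin 3) F) (hY : ∀ i j : Fin 3, j ≤ i → Y i j = 0)
    (n : ℕ) : ∀ i j : Fin 3, j ≤ i → (Y ^ (n + 1)) i j = 0 := by
  induction n with
  | zero => simpa using hY
  | succ n ih =>
    intro i j h
    rw [pow_succ, Matrix.mul_apply]
    refine Finset.sum_eq_zero fun k _ => ?_
    rcases le_or_gt k i with hk | hk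
    · rw [ih i k hk, zero_mul]
    · rw [hY k j (h.trans hk.le), mul_zero]

theorem det_evalMatrix (p : Polynomial F) (hp : p.coeff 0 = 1) (Y : nilradical) :
    (evalMatrix p Y).det = 1 := by
  have hY : ∀ i j : Fin 3, j ≤ i →
      ((Y : Matrix (Fin 3) (Fin 3) ℂ).map constF) i j = 0 := by
    intro i j h
    rw [Matrix.map_apply, Y.2 i j h, map_zero]
  have e : ∀ i j : Fin 3, j ≤ i → evalMatrix p Y i j = (1 : Matrix (Fin 3) (Fin 3) F) i j := by
    intro i j h
    rw [evalMatrix, Polynomial.aeval_eq_sum_range, Finset.sum_range_succ', hp, pow_zero, one_smul,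
      Matrix.add_apply, Matrix.sum_apply]
    rw [Finset.sum_eq_zero, zero_add]
    intro k _
    rw [Matrix.smul_apply, pow_upper _ hY k i j h, smul_eq_mul, mul_zero]
  have h00 := e 0 0 (by decide)
  have h10 := e 1 0 (by decide)
  have h11 := e 1 1 (by decide)
  have h20 := e 2 0 (by decide)
  have h21 := e 2 1 (by decide)
  have h22 := e 2 2 (by decide)
  simp at h00 h10 h11 h20 h21 h22
  rw [Matrix.det_fin_three, h00, h10, h11, h20, h21, h22]
  ring

/-- `p(Y)` as an element of `𝒢`, for `p` with constant term `1` and `Y ∈ 𝔟_u`. -/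
def evalLoop (p : Polynomial F) (hp : p.coeff 0 = 1) (Y : nilradical) : LoopG :=
  ⟨evalMatrix p Y, det_evalMatrix p hp Y⟩

theorem constLoop_mem_iwahori {b : G} (hb : b ∈ borel) : constLoop b ∈ iwahori := by
  refine ⟨SpecialLinearGroup.map (PowerSeries.C (R := ℂ)) b, ?_, ?_⟩
  · intro i j h
    simpa using hb i j h
  · refine Subtype.ext (Matrix.ext fun i j => ?_)
    change HahnSeries.ofPowerSeries ℤ ℂ (PowerSeries.C ((b : Matrix (Fin 3) (Fin 3) ℂ) i j)) =
      constF ((b : Matrix (Fin 3) (Fin 3) ℂ) i j)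
    rw [HahnSeries.ofPowerSeries_C]
    rfl

theorem evalMatrix_comm (p : Polynomial F) {b Y Y' : Matrix (Fin 3) (Fin 3) ℂ}
    (h : b * Y' = Y * b) :
    b.map constF * evalMatrix p Y' = evalMatrix p Y * b.map constF := by
  have h' : b.map constF * Y'.map constF =
      Y.map constF * b.map constF := by
    rw [← Matrix.map_mul, h, Matrix.map_mul]
  have hs : SemiconjBy (b.map constF) (Y'.map constF)
      (Y.map constF) := h'
  simp only [evalMatrix, Polynomial.aeval_eq_sum_range, Finset.mul_sum, Finset.sum_mul]
  refine Finset.sum_congr rfl fun k _ => ?_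
  have hk := (hs.pow_right k).eq
  rw [Algebra.mul_smul_comm, Algebra.smul_mul_assoc, hk]

/-- The map `ψ_p : T^*G/B → 𝒢/𝓑`, `(g, Y) ↦ g p(Y) (mod 𝓑)`. -/
def psi (p : Polynomial F) (hp : p.coeff 0 = 1) : Cotangent → AffineFlag :=
  Quotient.lift (fun x : G × nilradical => toFlag (constLoop x.1 * evalLoop p hp x.2)) (by
    rintro ⟨g, Y⟩ ⟨g', Y'⟩ ⟨b, hb, h1, h2⟩
    have e : (b : Matrix (Fin 3) (Fin 3) ℂ) * ((b⁻¹ : G) : Matrix (Fin 3) (Fin 3) ℂ) = 1 :=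
      congrArg Subtype.val (mul_inv_cancel b)
    have h3 : (b : Matrix (Fin 3) (Fin 3) ℂ) * (Y' : Matrix (Fin 3) (Fin 3) ℂ) =
        (Y : Matrix (Fin 3) (Fin 3) ℂ) * (b : Matrix (Fin 3) (Fin 3) ℂ) := by
      simp only at h2
      rw [h2, ← Matrix.mul_assoc, ← Matrix.mul_assoc, e, Matrix.one_mul]
    have h4 : constLoop b * evalLoop p hp Y' = evalLoop p hp Y * constLoop b :=
      Subtype.ext (evalMatrix_comm p h3)
    have h5 : constLoop g' * evalLoop p hp Y' =
        constLoop g * evalLoop p hp Y * constLoop b := by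
      simp only at h1
      rw [h1, map_mul, mul_assoc, h4, mul_assoc]
    refine QuotientGroup.eq.2 ?_
    rw [h5, inv_mul_cancel_left]
    exact constLoop_mem_iwahori hb)

/-- `ψ_p` realizes the affine Schubert variety `X(w)` as a compactification of `T^*G/B`: it is
injective and the closure of its image is `X(w)`. -/
def RealizesCompactification (p : Polynomial F) (hp : p.coeff 0 = 1) (w : AffineWeyl) : Prop :=
  Function.Injective (psi p hp) ∧ closure (Set.range (psi p hp)) = schubert w

end AffineFlagSL3

end

/-! Write `a` and `b` for the coefficients of degree 1 and 2 of `p`; as `Y ^ 3 = 0`, nothing else of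
`p` matters. If `a` had no pole, `p(E₁₂)` would lie in the Iwahori subgroup and `ψ_p` would identify
`(1, 0)` with `(1, E₁₂)`. So injectivity forces `a` to have order `k < 0`
(`exists_hasOrder_of_injective`), and this is the only use made of injectivity.

For the first claim take `g` to be a lift of the longest element of `S₃`. The cell of `g p(Y)` is
governed by the corner entry `c` and the lower right 2×2 minor, up to sign `d = c - a a'`, where `a`
and `a'` now include the scalars from `Y`. If both have a pole of order `m ≥ 2` that dominates the
poles of `a` and `a'`, Gaussian elimination reaches a translation of length at least `4m`. This is
arranged at once if `k ≤ -2`. If `k = -1`, the corner entry of `Y` can remove a simple pole from `c`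
or from `d`: either one of them can be made regular, giving an element of length at least 7, or both
have a common pole order at least 2 (`exists_longestLift_mul_mem_bruhatCell`). Lengths are bounded
below by counting inversions of affine permutations (`windowLength_le_length`).

For the second claim, a Schubert variety is stable under left multiplication by the Iwahori
subgroup. The closure of the image is not: the polynomial `flagRelation` vanishes on the image
(`flagRelation_image`), hence on its closure, but not at the translate of a suitable point by `1 + t
E₃₁` (`flagRelation_lowerShear_ne_zero`). -/

namespace AffineFlagSL3

open Matrix

/-! ### Orders of Laurent series -/

/-- The Laurent series `x` lies in `t ^ k A`. -/
def VanishBelow (k : ℤ) (x : F) : Prop := ∀ n < k, x.coeff n = 0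

/-- Bounded poles make each coefficient of a product a sum over an interval depending only on the
bounds; this is what makes multiplication polynomial in the coefficients. -/
theorem coeff_mul_eq_sum {k l : ℤ} {x y : F} (hx : VanishBelow k x) (hy : VanishBelow l y)
    (n : ℤ) : (x * y).coeff n = ∑ i ∈ Finset.Icc k (n - l), x.coeff i * y.coeff (n - i) := by
  rw [HahnSeries.coeff_mul]
  refine Finset.sum_bij_ne_zero (fun ij _ _ => ij.1) ?_ ?_ ?_ ?_
  · intro ij h h0
    rw [Finset.mem_antidiagonal] at h
    have h1 : k ≤ ij.1 := by
      by_contra! hc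
      exact h.1 (hx _ hc)
    have h2 : l ≤ ij.2 := by
      by_contra! hc
      exact h.2.1 (hy _ hc)
    rw [Finset.mem_Icc]
    have := h.2.2
    omega
  · intro ij h _ ij' h' _ e
    rw [Finset.mem_antidiagonal] at h h'
    refine Prod.ext e ?_
    have := h.2.2
    have := h'.2.2
    omega
  · intro i _ h0
    refine ⟨(i, n - i), ?_, h0, rfl⟩
    rw [Finset.mem_antidiagonal]
    exact ⟨left_ne_zero_of_mul h0, right_ne_zero_of_mul h0, by simp⟩
  · intro ij h _
    rw [Finset.mem_antidiagonal] at h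
    have : n - ij.1 = ij.2 := by
      have := h.2.2
      omega
    rw [this]

namespace VanishBelow

variable {k l : ℤ} {x y : F}

theorem mono (hx : VanishBelow k x) (h : l ≤ k) : VanishBelow l x :=
  fun n hn => hx n (hn.trans_le h)

theorem zero : VanishBelow k 0 := fun _ _ => rfl

theorem one : VanishBelow 0 1 := fun _ hn => HahnSeries.coeff_single_of_ne hn.ne

theorem constF (c : ℂ) : VanishBelow 0 (constF c) := fun _ hn => HahnSeries.coeff_single_of_ne hn.ne

theorem add (hx : VanishBelow k x) (hy : VanishBelow k y) : VanishBelow k (x + y) := fun n hn => by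
  rw [HahnSeries.coeff_add, hx n hn, hy n hn, add_zero]

theorem neg (hx : VanishBelow k x) : VanishBelow k (-x) := fun n hn => by
  rw [HahnSeries.coeff_neg, hx n hn, neg_zero]

theorem sub (hx : VanishBelow k x) (hy : VanishBelow k y) : VanishBelow k (x - y) := fun n hn => by
  rw [HahnSeries.coeff_sub, hx n hn, hy n hn, sub_zero]

theorem mul (hx : VanishBelow k x) (hy : VanishBelow l y) : VanishBelow (k + l) (x * y) :=
  fun n hn => by
    rw [coeff_mul_eq_sum hx hy, Finset.Icc_eq_empty (by omega), Finset.sum_empty]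

theorem sum {ι : Type*} {s : Finset ι} {f : ι → F} (h : ∀ i ∈ s, VanishBelow k (f i)) :
    VanishBelow k (∑ i ∈ s, f i) := fun n hn => by
  rw [HahnSeries.coeff_sum]
  exact Finset.sum_eq_zero fun i hi => h i hi n hn

theorem coeff_mul_add (hx : VanishBelow k x) (hy : VanishBelow l y) :
    (x * y).coeff (k + l) = x.coeff k * y.coeff l := by
  rw [coeff_mul_eq_sum hx hy, add_sub_cancel_right, Finset.Icc_self, Finset.sum_singleton,
    add_sub_cancel_left]

end VanishBelow

/-- The Laurent series `x` has order exactly `k`. -/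
def HasOrder (k : ℤ) (x : F) : Prop := VanishBelow k x ∧ x.coeff k ≠ 0

theorem exists_hasOrder {x : F} (hx : x ≠ 0) : ∃ k, HasOrder k x :=
  ⟨x.order, fun _ hn => HahnSeries.coeff_eq_zero_of_lt_order hn,
    HahnSeries.coeff_order_eq_zero.not.2 hx⟩

theorem vanishBelow_or_hasOrder (x : F) (k : ℤ) : VanishBelow k x ∨ ∃ n < k, HasOrder n x := by
  by_cases hx : x = 0
  · exact .inl (hx ▸ VanishBelow.zero)
  · obtain ⟨n, hn⟩ := exists_hasOrder hx
    rcases lt_or_ge n k with h | h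
    · exact .inr ⟨n, h, hn⟩
    · exact .inl (hn.1.mono h)

namespace HasOrder

variable {k l : ℤ} {x y : F}

theorem ne_zero (hx : HasOrder k x) : x ≠ 0 := by
  rintro rfl
  exact hx.2 rfl

theorem one : HasOrder 0 1 := ⟨VanishBelow.one, by simp⟩

theorem neg (hx : HasOrder k x) : HasOrder k (-x) := ⟨hx.1.neg, by simpa using hx.2⟩

theorem mul (hx : HasOrder k x) (hy : HasOrder l y) : HasOrder (k + l) (x * y) :=
  ⟨hx.1.mul hy.1, by rw [hx.1.coeff_mul_add hy.1]; exact mul_ne_zero hx.2 hy.2⟩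

theorem unique (hx : HasOrder k x) (hy : HasOrder l x) : k = l := by
  rcases lt_trichotomy k l with h | h | h
  · exact absurd (hy.1 k h) hx.2
  · exact h
  · exact absurd (hx.1 l h) hy.2

theorem inv (hx : HasOrder k x) : HasOrder (-k) x⁻¹ := by
  obtain ⟨l, hl⟩ := exists_hasOrder (inv_ne_zero hx.ne_zero)
  have h := hx.mul hl
  rw [mul_inv_cancel₀ hx.ne_zero] at h
  have := h.unique one
  rwa [show -k = l by omega]

theorem div (hx : HasOrder k x) (hy : HasOrder l y) : HasOrder (k - l) (x / y) := by
  rw [div_eq_mul_inv, sub_eq_add_neg]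
  exact hx.mul hy.inv

theorem add_left (hx : HasOrder k x) (hy : VanishBelow (k + 1) y) : HasOrder k (y + x) :=
  ⟨(hy.mono (by omega)).add hx.1, by
    rw [HahnSeries.coeff_add, hy k (by omega), zero_add]
    exact hx.2⟩

end HasOrder

theorem VanishBelow.div {k l : ℤ} {x y : F} (hx : VanishBelow k x) (hy : HasOrder l y) :
    VanishBelow (k - l) (x / y) := by
  rw [div_eq_mul_inv, sub_eq_add_neg]
  exact hx.mul hy.inv.1

theorem hasOrder_single (k : ℤ) {c : ℂ} (hc : c ≠ 0) :
    HasOrder k (HahnSeries.single k c : F) :=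
  ⟨fun _ hn => HahnSeries.coeff_single_of_ne hn.ne, by simpa using hc⟩

theorem coeff_constF_mul (c : ℂ) (x : F) (n : ℤ) : (constF c * x).coeff n = c * x.coeff n := by
  rw [constF, HahnSeries.C_mul_eq_smul, HahnSeries.coeff_smul, smul_eq_mul]

/-! ### The Iwahori subgroup, `p(Y)` in coordinates, and the pole forced by injectivity -/

theorem mem_iwahori_iff {x : LoopG} :
    x ∈ iwahori ↔ (∀ i j, VanishBelow 0 (x.1 i j)) ∧ ∀ i j, j < i → (x.1 i j).coeff 0 = 0 := by
  constructor
  · rintro ⟨y, hy, rfl⟩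
    refine ⟨fun i j n hn => ?_, fun i j hij => ?_⟩
    · change ((y.1 i j : A) : F).coeff n = 0
      rw [PowerSeries.coeff_coe, if_pos hn]
    · change ((y.1 i j : A) : F).coeff 0 = 0
      rw [PowerSeries.coeff_coe, if_neg (by simp)]
      simpa using hy i j hij
  · rintro ⟨h, h'⟩
    let y : Matrix (Fin 3) (Fin 3) A := fun i j => PowerSeries.mk fun n => (x.1 i j).coeff n
    have hy : y.map (algebraMap A F) = x.1 := by
      ext i j n
      change ((y i j : A) : F).coeff n = _
      rw [PowerSeries.coeff_coe]
      split_ifs with hn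
      · exact (h i j n hn).symm
      · simp only [y, PowerSeries.coeff_mk]
        rw [Int.natAbs_of_nonneg (by omega)]
    have hdet : y.det = 1 := by
      refine IsFractionRing.injective A F ?_
      rw [RingHom.map_det, map_one, RingHom.mapMatrix_apply, hy, x.2]
    refine ⟨⟨y, hdet⟩, fun i j hij => ?_, Subtype.ext hy⟩
    have : PowerSeries.constantCoeff (y i j) = 0 := by
      rw [← PowerSeries.coeff_zero_eq_constantCoeff_apply]
      simpa [y] using h' i j hij
    exact this

/-- `p(Y)` in coordinates, where `a` and `b` are the coefficients of degree `1` and `2`. -/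
theorem evalMatrix_eq (p : Polynomial F) (hp : p.coeff 0 = 1) (Y : nilradical) :
    evalMatrix p Y = !![1, constF (Y.1 0 1) * p.coeff 1,
        constF (Y.1 0 2) * p.coeff 1 + constF (Y.1 0 1 * Y.1 1 2) * p.coeff 2;
      0, 1, constF (Y.1 1 2) * p.coeff 1; 0, 0, 1] := by
  obtain ⟨Y, hY⟩ := Y
  set Z : Matrix (Fin 3) (Fin 3) F := Y.map constF with hZ
  have eZ : Z = !![0, constF (Y 0 1), constF (Y 0 2); 0, 0, constF (Y 1 2); 0, 0, 0] := by
    ext i j : 1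
    rw [hZ, Matrix.map_apply]
    fin_cases i <;> fin_cases j <;> simp <;> exact hY _ _ (by decide)
  have eZ2 : Z ^ 2 = !![0, 0, constF (Y 0 1 * Y 1 2); 0, 0, 0; 0, 0, 0] := by
    rw [sq, eZ, map_mul]
    ext i j : 1
    fin_cases i <;> fin_cases j <;> simp [Matrix.mul_apply, Fin.sum_univ_three]
  have eZ3 : Z ^ 3 = 0 := by
    rw [pow_succ, eZ2, eZ]
    ext i j : 1
    fin_cases i <;> fin_cases j <;> simp [Matrix.mul_apply, Fin.sum_univ_three]
  have e : evalMatrix p Y = 1 + p.coeff 1 • Z + p.coeff 2 • Z ^ 2 := by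
    -- The range is padded by 3 so that the three lowest terms can be split off whatever the degree
    -- of `p`.
    rw [evalMatrix, ← hZ, Polynomial.aeval_eq_sum_range' (n := p.natDegree + 3) (by omega),
      Finset.sum_range_succ', Finset.sum_range_succ', Finset.sum_range_succ',
      Finset.sum_eq_zero, hp]
    · simp only [zero_add, pow_zero, one_smul, pow_one]
      abel
    · intro k _
      rw [show k + 1 + 1 + 1 = k + 3 by ring, pow_add, eZ3, mul_zero, smul_zero]
  change evalMatrix p Y = _
  rw [e, eZ2, eZ]
  ext i j : 1
  fin_cases i <;> fin_cases j <;> simp [mul_comm]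

/-- The element of `𝔟_u` with entries `x`, `y` above the diagonal and `z` in the corner. -/
def nilradicalMk (x y z : ℂ) : nilradical :=
  ⟨!![0, x, z; 0, 0, y; 0, 0, 0], by
    intro i j h
    fin_cases i <;> fin_cases j <;> first | rfl | exact absurd h (by decide)⟩

theorem evalLoop_nilradicalMk (p : Polynomial F) (hp : p.coeff 0 = 1) (x y z : ℂ) :
    (evalLoop p hp (nilradicalMk x y z)).1 = !![1, constF x * p.coeff 1,
        constF z * p.coeff 1 + constF (x * y) * p.coeff 2;
      0, 1, constF y * p.coeff 1; 0, 0, 1] :=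
  evalMatrix_eq p hp _

theorem psi_mk (p : Polynomial F) (hp : p.coeff 0 = 1) (g : G) (Y : nilradical) :
    psi p hp (Cotangent.mk g Y) = toFlag (constLoop g * evalLoop p hp Y) := rfl

theorem toFlag_eq_iff {x y : LoopG} : toFlag x = toFlag y ↔ x⁻¹ * y ∈ iwahori := QuotientGroup.eq

/-- If `ψ_p` is injective, then the linear coefficient of `p` has a pole. -/
theorem exists_hasOrder_of_injective (p : Polynomial F) (hp : p.coeff 0 = 1)
    (h : Function.Injective (psi p hp)) : ∃ k < 0, HasOrder k (p.coeff 1) := by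
  refine (vanishBelow_or_hasOrder _ 0).resolve_left fun h0 => ?_
  have e : psi p hp (Cotangent.mk 1 (nilradicalMk 0 0 0)) =
      psi p hp (Cotangent.mk 1 (nilradicalMk 1 0 0)) := by
    rw [psi_mk, psi_mk, toFlag_eq_iff, map_one, one_mul, one_mul]
    have e1 : evalLoop p hp (nilradicalMk 0 0 0) = 1 := by
      refine Subtype.ext ?_
      rw [evalLoop_nilradicalMk]
      ext i j : 1
      fin_cases i <;> fin_cases j <;> simp
    rw [e1, inv_one, one_mul, mem_iwahori_iff, evalLoop_nilradicalMk]
    constructor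
    · intro i j
      fin_cases i <;> fin_cases j <;> simp [VanishBelow.zero, VanishBelow.one, h0]
    · intro i j hij
      fin_cases i <;> fin_cases j <;> first | rfl | exact absurd hij (by decide)
  obtain ⟨b, -, -, hb⟩ := Quotient.exact (h e).symm
  have e0 : (nilradicalMk 0 0 0).1 = 0 := by
    ext i j : 1
    fin_cases i <;> fin_cases j <;> rfl
  have h1 : (b : Matrix (Fin 3) (Fin 3) ℂ) * ((b⁻¹ : G) : Matrix (Fin 3) (Fin 3) ℂ) = 1 :=
    congrArg Subtype.val (mul_inv_cancel b)
  -- Equality in `T^*G/B` makes the two nilpotent matrices conjugate, and only 0 is conjugate to 0.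
  have h2 : (nilradicalMk 1 0 0).1 = 0 := by
    have := congrArg (fun M => b.1 * M * (b⁻¹ : G).1) hb
    simp only [e0, ← Matrix.mul_assoc, h1, Matrix.mul_zero, Matrix.zero_mul, Matrix.one_mul] at this
    rw [Matrix.mul_assoc, h1, Matrix.mul_one] at this
    exact this.symm
  have := congrFun (congrFun h2 0) 1
  simp [nilradicalMk] at this

/-! ### The Zariski closure of the image of `ψ_p` -/

/-- The matrix of coefficients of `t ^ k` in the entries of `x`. -/
def coeffMatrix (x : LoopG) (k : ℤ) : Matrix (Fin 3) (Fin 3) ℂ := of fun i j => coords x (i, j, k)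

theorem coeffMatrix_constLoop_mul (g : G) (x : LoopG) (k : ℤ) :
    coeffMatrix (constLoop g * x) k = g.1 * coeffMatrix x k := by
  ext i j
  change (((g.1.map constF) * x.1) i j).coeff k = _
  rw [Matrix.mul_apply, Matrix.mul_apply, HahnSeries.coeff_sum]
  exact Finset.sum_congr rfl fun l _ => coeff_constF_mul _ _ _

/-- The common zeros of all polynomials in the coefficients that vanish on `S`. -/
def loopClosure (S : Set LoopG) : Set LoopG :=
  {x | ∀ f : MvPolynomial (Fin 3 × Fin 3 × ℤ) ℂ,
    (∀ y ∈ S, MvPolynomial.eval (coords y) f = 0) → MvPolynomial.eval (coords x) f = 0}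

theorem subset_loopClosure (S : Set LoopG) : S ⊆ loopClosure S := fun _ hx _ hf => hf _ hx

theorem vanishBelow_of_mem_loopClosure {S : Set LoopG} {k : ℤ}
    (hS : ∀ x ∈ S, ∀ i j, VanishBelow k (x.1 i j)) {x : LoopG} (hx : x ∈ loopClosure S)
    (i j : Fin 3) : VanishBelow k (x.1 i j) := by
  intro n hn
  have := hx (MvPolynomial.X (i, j, n)) fun y hy => by
    rw [MvPolynomial.eval_X]
    exact hS y hy i j n hn
  rwa [MvPolynomial.eval_X] at this

/-- Right multiplication by `b` pulls a polynomial vanishing on `S` back to a polynomial vanishing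
on `S`. The uniform pole bound `k` is what keeps the substitution polynomial. -/
theorem mul_mem_loopClosure {S : Set LoopG} {k : ℤ}
    (hS : ∀ x ∈ S, ∀ i j, VanishBelow k (x.1 i j))
    (hSb : ∀ x ∈ S, ∀ b ∈ iwahori, x * b ∈ S) {x b : LoopG} (hx : x ∈ loopClosure S)
    (hb : b ∈ iwahori) : x * b ∈ loopClosure S := by
  intro f hf
  -- The coordinates of `x * b` in terms of those of `x`: the sum starts at the pole bound for `x`
  -- and stops at the target degree because `b` has no poles.
  let φ : Fin 3 × Fin 3 × ℤ → MvPolynomial (Fin 3 × Fin 3 × ℤ) ℂ := fun c =>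
    ∑ l, ∑ m ∈ Finset.Icc k c.2.2,
      MvPolynomial.X (c.1, l, m) * MvPolynomial.C (coords b (l, c.2.1, c.2.2 - m))
  have key : ∀ y : LoopG, (∀ i j, VanishBelow k (y.1 i j)) →
      MvPolynomial.eval (coords y) (MvPolynomial.bind₁ φ f) =
        MvPolynomial.eval (coords (y * b)) f := by
    intro y hy
    rw [← MvPolynomial.coe_aeval_eq_eval, ← MvPolynomial.coe_aeval_eq_eval]
    change MvPolynomial.aeval _ _ = MvPolynomial.aeval _ _
    rw [MvPolynomial.aeval_bind₁]
    congr 2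
    ext ⟨i, j, n⟩
    change _ = ((y.1 * b.1) i j).coeff n
    rw [Matrix.mul_apply, HahnSeries.coeff_sum, map_sum]
    refine Finset.sum_congr rfl fun l _ => ?_
    rw [coeff_mul_eq_sum (hy i l) ((mem_iwahori_iff.1 hb).1 l j), map_sum, sub_zero]
    refine Finset.sum_congr rfl fun m _ => ?_
    simp [coords]
  rw [← key x (vanishBelow_of_mem_loopClosure hS hx)]
  refine hx _ fun y hy => ?_
  rw [key y (hS y hy)]
  exact hf _ (hSb y hy b hb)

/-- By right stability `loopClosure S` is a union of Iwahori cosets, so it is the full preimage of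
its image in the flag variety and its equations define a closed set there. -/
theorem toFlag_mem_image_loopClosure {S : Set LoopG} {k : ℤ}
    (hS : ∀ x ∈ S, ∀ i j, VanishBelow k (x.1 i j))
    (hSb : ∀ x ∈ S, ∀ b ∈ iwahori, x * b ∈ S) {x : LoopG} :
    toFlag x ∈ toFlag '' loopClosure S ↔ x ∈ loopClosure S := by
  refine ⟨?_, fun h => ⟨x, h, rfl⟩⟩
  rintro ⟨y, hy, e⟩
  have := mul_mem_loopClosure hS hSb hy (toFlag_eq_iff.1 e)
  rwa [mul_inv_cancel_left] at this

theorem isClosed_image_loopClosure {S : Set LoopG} {k : ℤ}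
    (hS : ∀ x ∈ S, ∀ i j, VanishBelow k (x.1 i j))
    (hSb : ∀ x ∈ S, ∀ b ∈ iwahori, x * b ∈ S) : IsClosed (toFlag '' loopClosure S) := by
  rw [← isOpen_compl_iff]
  change (toFlag '' loopClosure S)ᶜᶜ ∈ {S | IsZariskiClosed S}
  rw [compl_compl]
  intro N
  exact ⟨{f | ∀ y ∈ S, MvPolynomial.eval (coords y) f = 0}, fun x _ =>
    toFlag_mem_image_loopClosure hS hSb⟩

/-- The preimage in `𝒢` of the image of `ψ_p`. -/
def imageLoops (p : Polynomial F) (hp : p.coeff 0 = 1) : Set LoopG :=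
  {x | ∃ g Y, ∃ b ∈ iwahori, x = constLoop g * evalLoop p hp Y * b}

theorem mul_mem_imageLoops {p : Polynomial F} {hp : p.coeff 0 = 1} {x b : LoopG}
    (hx : x ∈ imageLoops p hp) (hb : b ∈ iwahori) : x * b ∈ imageLoops p hp := by
  obtain ⟨g, Y, c, hc, rfl⟩ := hx
  exact ⟨g, Y, c * b, mul_mem hc hb, mul_assoc _ _ _⟩

theorem exists_vanishBelow (x : F) : ∃ k ≤ 0, VanishBelow k x :=
  ⟨min x.order 0, min_le_right _ _, fun _ hn =>
    HahnSeries.coeff_eq_zero_of_lt_order (hn.trans_le (min_le_left _ _))⟩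

theorem VanishBelow.constF_mul {k : ℤ} {x : F} (c : ℂ) (hx : VanishBelow k x) :
    VanishBelow k (AffineFlagSL3.constF c * x) := by
  simpa using (VanishBelow.constF c).mul hx

theorem exists_vanishBelow_imageLoops (p : Polynomial F) (hp : p.coeff 0 = 1) :
    ∃ k, ∀ x ∈ imageLoops p hp, ∀ i j, VanishBelow k (x.1 i j) := by
  obtain ⟨k, hk0, hk⟩ := exists_vanishBelow (p.coeff 1)
  obtain ⟨l, hl0, hl⟩ := exists_vanishBelow (p.coeff 2)
  have hY : ∀ Y i j, VanishBelow (min k l) ((evalLoop p hp Y).1 i j) := by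
    intro Y i j
    -- The bounds were chosen nonpositive so that they also cover the diagonal entries 1.
    have h1 : VanishBelow (min k l) 1 := VanishBelow.one.mono (by omega)
    have h2 := hk.mono (min_le_left k l)
    have h3 := hl.mono (min_le_right k l)
    change VanishBelow _ (evalMatrix p Y i j)
    rw [evalMatrix_eq p hp]
    fin_cases i <;> fin_cases j
    · exact h1
    · exact h2.constF_mul _
    · exact (h2.constF_mul _).add (h3.constF_mul _)
    · exact VanishBelow.zero
    · exact h1
    · exact h2.constF_mul _
    · exact VanishBelow.zero
    · exact VanishBelow.zero
    · exact h1
  refine ⟨min k l, ?_⟩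
  rintro _ ⟨g, Y, b, hb, rfl⟩ i j
  change VanishBelow _ (((g.1.map constF * (evalLoop p hp Y).1) * b.1) i j)
  rw [Matrix.mul_apply]
  refine VanishBelow.sum fun m _ => ?_
  rw [Matrix.mul_apply]
  simpa using (VanishBelow.sum (k := min k l) fun n _ => (hY Y n m).constF_mul _).mul
    ((mem_iwahori_iff.1 hb).1 m j)

theorem closure_range_psi_subset (p : Polynomial F) (hp : p.coeff 0 = 1) :
    closure (Set.range (psi p hp)) ⊆ toFlag '' loopClosure (imageLoops p hp) := by
  obtain ⟨k, hk⟩ := exists_vanishBelow_imageLoops p hp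
  refine closure_minimal ?_ (isClosed_image_loopClosure hk fun _ hx _ hb =>
    mul_mem_imageLoops hx hb)
  rintro _ ⟨⟨g, Y⟩, rfl⟩
  exact ⟨_, subset_loopClosure _ ⟨g, Y, 1, one_mem _, rfl⟩, by rw [mul_one]; rfl⟩

theorem toFlag_mul_mem_schubert {w : AffineWeyl} {h x : LoopG} (hh : h ∈ iwahori)
    (hx : toFlag x ∈ schubert w) : toFlag (h * x) ∈ schubert w := by
  simp only [schubert, Set.mem_iUnion] at hx ⊢
  obtain ⟨τ, hτ, y, ⟨n, hn, b, hb, b', hb', rfl⟩, e⟩ := hx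
  refine ⟨τ, hτ, _, ⟨n, hn, h * b, mul_mem hh hb, b', hb', rfl⟩, ?_⟩
  rw [toFlag_eq_iff] at e ⊢
  simpa [mul_assoc] using e

/-- If some polynomial vanishes on the image of `ψ_p`, but not on its translate by an element of
`𝓑`, then the closure of the image is not a Schubert variety. -/
theorem closure_range_psi_ne_schubert (p : Polynomial F) (hp : p.coeff 0 = 1)
    (f : MvPolynomial (Fin 3 × Fin 3 × ℤ) ℂ)
    (hf : ∀ g Y, ∀ b ∈ iwahori,
      MvPolynomial.eval (coords (constLoop g * (evalLoop p hp Y * b))) f = 0)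
    {h : LoopG} (hh : h ∈ iwahori) (Y : nilradical)
    (hY : MvPolynomial.eval (coords (h * evalLoop p hp Y)) f ≠ 0) (w : AffineWeyl) :
    closure (Set.range (psi p hp)) ≠ schubert w := by
  intro e
  obtain ⟨k, hk⟩ := exists_vanishBelow_imageLoops p hp
  have h1 : toFlag (evalLoop p hp Y) ∈ schubert w := by
    rw [← e]
    refine subset_closure ⟨Cotangent.mk 1 Y, ?_⟩
    rw [psi_mk, map_one, one_mul]
  have h2 := toFlag_mul_mem_schubert hh h1
  rw [← e] at h2
  have h3 := (toFlag_mem_image_loopClosure hk fun _ hx _ hb => mul_mem_imageLoops hx hb).1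
    (closure_range_psi_subset p hp h2)
  refine hY (h3 f ?_)
  rintro _ ⟨g, Y, b, hb, rfl⟩
  rw [mul_assoc]
  exact hf g Y b hb

/-! ### An equation of the image that is not Iwahori-invariant -/

/-- A relation between the coefficients `c (i, j, n)` of `t ^ n` in the entries `x i j` of a
matrix. It is satisfied on the image of `ψ_p` when the linear coefficient of `p` has order `k`. -/
def flagRelation {K : Type*} [CommRing K] (k : ℤ) (c : Fin 3 × Fin 3 × ℤ → K) : K :=
  let col (j : Fin 3) (n : ℤ) : Fin 3 → K := fun i => c (i, j, n)
  let D (u : Fin 3 → K) : K := det (of ![u, col 1 k, col 2 k])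
  let v : Fin 3 → K := D (col 2 0) • col 0 (k + 1) - D (col 0 1) • col 2 k
  v 0 * col 1 k 1 - v 1 * col 1 k 0

theorem eval_flagRelation (k : ℤ) (c : Fin 3 × Fin 3 × ℤ → ℂ) :
    MvPolynomial.eval c (flagRelation k MvPolynomial.X) = flagRelation k c := by
  simp [flagRelation, det_fin_three]

theorem vanishBelow_one_of_mem_iwahori {b : LoopG} (hb : b ∈ iwahori) {i j : Fin 3} (h : j < i) :
    VanishBelow 1 (b.1 i j) := by
  intro n hn
  rcases lt_or_eq_of_le (show n ≤ 0 by omega) with h0 | rfl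
  · exact (mem_iwahori_iff.1 hb).1 i j n h0
  · exact (mem_iwahori_iff.1 hb).2 i j h

/-- Let `y = p(Y) b`. After undoing `g`, the `t ^ k` coefficient of column 1 is a multiple of `e₀`,
and that of column 2 lies in `⟨e₀, e₁⟩`. Hence `D u` is a multiple of the last coordinate of `u`.
The combination `v` is built so that its `e₁` coordinate cancels, so `v` is also a multiple of `e₀`;
the relation is a 2×2 minor of these two parallel vectors. -/
theorem flagRelation_image {p : Polynomial F} (hp : p.coeff 0 = 1) {k : ℤ} (hk : k < 0)
    (ha : VanishBelow k (p.coeff 1)) (g : G) (Y : nilradical) {b : LoopG} (hb : b ∈ iwahori) :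
    flagRelation k (coords (constLoop g * (evalLoop p hp Y * b))) = 0 := by
  set y := evalLoop p hp Y * b with hy
  have hg : ∀ i j n, coords (constLoop g * y) (i, j, n) =
      ∑ l, g.1 i l * coords y (l, j, n) := fun i j n => by
    have := congrFun (congrFun (coeffMatrix_constLoop_mul g y n) i) j
    rwa [Matrix.mul_apply] at this
  have hb0 := (mem_iwahori_iff.1 hb).1
  have hb1 : ∀ i j, j < i → VanishBelow 1 (b.1 i j) := fun i j h =>
    vanishBelow_one_of_mem_iwahori hb h
  -- The last row of `p(Y)` is `(0, 0, 1)`, so the last row of `y` is that of `b`.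
  have e2 : ∀ j n, coords y (2, j, n) = (b.1 2 j).coeff n := by
    intro j n
    change ((evalMatrix p Y * b.1) 2 j).coeff n = _
    rw [evalMatrix_eq p hp, Matrix.mul_apply]
    simp [Fin.sum_univ_three]
  set a' := constF (Y.1 1 2) * p.coeff 1 with ha'
  have hA : VanishBelow k a' := ha.constF_mul _
  have e1 : ∀ j n, coords y (1, j, n) = (b.1 1 j).coeff n + (a' * b.1 2 j).coeff n := by
    intro j n
    change ((evalMatrix p Y * b.1) 1 j).coeff n = _
    rw [evalMatrix_eq p hp, Matrix.mul_apply]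
    simp [Fin.sum_univ_three, ha']
  have h1 : coords y (1, 1, k) = 0 := by
    rw [e1, hb0 1 1 k hk, zero_add]
    exact hA.mul (hb1 2 1 (by decide)) _ (by omega)
  have h2 : coords y (2, 1, k) = 0 := by rw [e2, hb0 2 1 k hk]
  have h3 : coords y (1, 2, k) = a'.coeff k * (b.1 2 2).coeff 0 := by
    rw [e1, hb0 1 2 k hk, zero_add]
    simpa using hA.coeff_mul_add (hb0 2 2)
  have h4 : coords y (2, 2, k) = 0 := by rw [e2, hb0 2 2 k hk]
  have h5 : coords y (1, 0, k + 1) = a'.coeff k * (b.1 2 0).coeff 1 := by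
    rw [e1, hb1 1 0 (by decide) (k + 1) (by omega), zero_add]
    exact hA.coeff_mul_add (hb1 2 0 (by decide))
  have h6 : coords y (2, 0, k + 1) = 0 := by rw [e2, hb1 2 0 (by decide) (k + 1) (by omega)]
  have h7 := e2 2 0
  have h8 := e2 0 1
  simp only [flagRelation, hg, Fin.sum_univ_three, Pi.sub_apply, Pi.smul_apply, smul_eq_mul,
    det_fin_three, of_apply, cons_val', cons_val_zero, cons_val_one, cons_val]
  simp only [h1, h2, h3, h4, h5, h6, h7, h8]
  ring

/-- The elementary matrix `1 + t E₃₁`. -/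
noncomputable def lowerShear : LoopG :=
  ⟨!![1, 0, 0; 0, 1, 0; HahnSeries.single 1 1, 0, 1], by simp [det_fin_three]⟩

theorem lowerShear_mem_iwahori : lowerShear ∈ iwahori := by
  have h : VanishBelow 0 (HahnSeries.single 1 1 : F) :=
    (hasOrder_single 1 one_ne_zero).1.mono (by norm_num)
  rw [mem_iwahori_iff]
  constructor
  · intro i j
    fin_cases i <;> fin_cases j <;>
      simp [lowerShear, VanishBelow.one, VanishBelow.zero, h]
  · intro i j hij
    fin_cases i <;> fin_cases j <;> first
      | exact absurd hij (by decide)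
      | simp [lowerShear]

/-- The shear places `t` in the lower left corner, so `D (col 0 1)` equals the square of the leading
coefficient of `a`, with nothing to cancel it in `v 1`. The relation evaluates to the fourth power
of that coefficient. -/
theorem flagRelation_lowerShear_ne_zero {p : Polynomial F} (hp : p.coeff 0 = 1) {k : ℤ}
    (hk : k < 0) (ha : HasOrder k (p.coeff 1)) :
    flagRelation k (coords (lowerShear * evalLoop p hp (nilradicalMk 1 1 0))) ≠ 0 := by
  set a := p.coeff 1 with ha'
  set b := p.coeff 2 with hb'
  set t : F := HahnSeries.single 1 1 with ht
  have e : (lowerShear * evalLoop p hp (nilradicalMk 1 1 0)).1 =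
      !![1, a, b; 0, 1, a; t, t * a, t * b + 1] := by
    change lowerShear.1 * _ = _
    rw [evalLoop_nilradicalMk]
    ext i j : 1
    fin_cases i <;> fin_cases j <;>
      simp [lowerShear, Matrix.mul_apply, Fin.sum_univ_three, ← ha', ← hb', ← ht]
  have hc : ∀ i j n, coords (lowerShear * evalLoop p hp (nilradicalMk 1 1 0)) (i, j, n) =
      ((!![1, a, b; 0, 1, a; t, t * a, t * b + 1] : Matrix (Fin 3) (Fin 3) F) i j).coeff n := by
    intro i j n
    rw [← e]
    rfl
  have h2 : (t * a).coeff k = 0 :=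
    ((hasOrder_single 1 one_ne_zero).1.mul ha.1) k (by omega)
  have h4 : t.coeff 1 = 1 := by simp [ht]
  have key : flagRelation k (coords (lowerShear * evalLoop p hp (nilradicalMk 1 1 0))) =
      a.coeff k ^ 4 := by
    simp [flagRelation, hc, det_fin_three, h2, h4, hk.ne]
    ring
  rw [key]
  exact pow_ne_zero _ ha.2

theorem not_realizesCompactification (p : Polynomial F) (hp : p.coeff 0 = 1) (w : AffineWeyl) :
    ¬ RealizesCompactification p hp w := by
  rintro ⟨hi, hw⟩
  obtain ⟨k, hk, ha⟩ := exists_hasOrder_of_injective p hp hi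
  refine closure_range_psi_ne_schubert p hp (flagRelation k MvPolynomial.X) (fun g Y b hb => ?_)
    lowerShear_mem_iwahori (nilradicalMk 1 1 0) ?_ w hw
  · rw [eval_flagRelation, flagRelation_image hp hk ha.1 g Y hb]
  · rw [eval_flagRelation]
    exact flagRelation_lowerShear_ne_zero hp hk ha

/-! ### Windows of affine permutations and a lower bound for the Coxeter length -/

/-- `M` is a monomial matrix whose `j`-th column has its only nonzero entry, a multiple of
`t ^ (-q)`, in row `r`, where `f j = 3 q + r`: the window notation of an affine permutation. -/
def IsWindow (M : Matrix (Fin 3) (Fin 3) R) (f : Fin 3 → ℤ) : Prop :=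
  ∀ j, ∃ c : ℂ, c ≠ 0 ∧ ∀ i : Fin 3, M i j =
    if ((i : ℕ) : ℤ) = f j % 3 then LaurentPolynomial.C c * LaurentPolynomial.T (-(f j / 3)) else 0

/-- The effect on windows of right multiplication by a simple reflection. -/
def windowStep (f : Fin 3 → ℤ) : Fin 3 → Fin 3 → ℤ
  | 0 => ![f 2 - 3, f 1, f 0 + 3]
  | 1 => ![f 1, f 0, f 2]
  | 2 => ![f 0, f 2, f 1]

/-- The number of inversions of an affine permutation given by its window. -/
def windowLength (f : Fin 3 → ℤ) : ℕ :=
  ((f 1 - f 0) / 3).natAbs + ((f 2 - f 0) / 3).natAbs + ((f 2 - f 1) / 3).natAbs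

/-- The entries of the window are pairwise incongruent modulo `3`. -/
def WindowRegular (f : Fin 3 → ℤ) : Prop :=
  (f 1 - f 0) % 3 ≠ 0 ∧ (f 2 - f 0) % 3 ≠ 0 ∧ (f 2 - f 1) % 3 ≠ 0

theorem WindowRegular.windowStep {f : Fin 3 → ℤ} (hf : WindowRegular f) (s : Fin 3) :
    WindowRegular (windowStep f s) := by
  obtain ⟨h1, h2, h3⟩ := hf
  fin_cases s <;> refine ⟨?_, ?_, ?_⟩ <;> simp [AffineFlagSL3.windowStep] <;> omega

/-- When 3 does not divide `x`, the floor of `-x/3` is `-⌊x/3⌋ - 1`. Hence each step permutes two of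
the three absolute values and changes the third by at most 1; regularity supplies the
nondivisibility. -/
theorem windowLength_windowStep_le {f : Fin 3 → ℤ} (hf : WindowRegular f) (s : Fin 3) :
    windowLength (windowStep f s) ≤ windowLength f + 1 := by
  obtain ⟨h1, h2, h3⟩ := hf
  fin_cases s <;> simp [windowStep, windowLength] <;> omega

theorem IsWindow.unique {M : Matrix (Fin 3) (Fin 3) R} {f f' : Fin 3 → ℤ} (h : IsWindow M f)
    (h' : IsWindow M f') : f = f' := by
  ext j
  obtain ⟨c, hc, e⟩ := h j
  obtain ⟨c', hc', e'⟩ := h' j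
  -- The residue of `f j` locates the nonzero entry of column `j`; its exponent then recovers the
  -- quotient.
  obtain ⟨i, hi⟩ : ∃ i : Fin 3, ((i : ℕ) : ℤ) = f j % 3 :=
    ⟨⟨(f j % 3).toNat, by omega⟩, by simp; omega⟩
  have h1 := e i
  rw [e' i, if_pos hi, ← LaurentPolynomial.single_eq_C_mul_T,
    ← LaurentPolynomial.single_eq_C_mul_T] at h1
  split_ifs at h1 with hi'
  · have := (Finsupp.single_eq_single_iff _ _ _ _).1 (congrArg AddMonoidAlgebra.coeff h1)
    have := this.resolve_right fun h => hc h.2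
    omega
  · exact absurd (AddMonoidAlgebra.single_eq_zero.1 h1.symm) hc

theorem IsWindow.mul_torus {M : Matrix (Fin 3) (Fin 3) R} {f : Fin 3 → ℤ} (h : IsWindow M f)
    {t : SpecialLinearGroup (Fin 3) R} (ht : t ∈ constTorus) : IsWindow (M * t.1) f := by
  obtain ⟨g, hg, rfl⟩ := ht
  intro j
  obtain ⟨c, hc, e⟩ := h j
  have hg' : g.1 = diagonal fun i => g.1 i i := by
    ext a b : 1
    by_cases hab : a = b
    · rw [hab, diagonal_apply_eq]
    · rw [diagonal_apply_ne _ hab, hg a b hab]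
  have hd : ∏ i, g.1 i i = 1 := by
    rw [← det_diagonal, ← hg', g.2]
  refine ⟨c * g.1 j j, mul_ne_zero hc fun h0 => ?_, fun i => ?_⟩
  · have hd := hd.symm.trans (Finset.prod_eq_zero (Finset.mem_univ j) h0)
    exact one_ne_zero hd
  · have : (SpecialLinearGroup.map (LaurentPolynomial.C (R := ℂ)) g).1 =
        diagonal fun i => LaurentPolynomial.C (g.1 i i) := by
      change g.1.map LaurentPolynomial.C = _
      conv_lhs => rw [hg']
      exact diagonal_map (map_zero _)
    rw [this, mul_diagonal, e i, map_mul]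
    split_ifs
    · ring
    · rw [zero_mul]

theorem isWindow_one : IsWindow 1 ![0, 1, 2] := by
  intro j
  refine ⟨1, one_ne_zero, fun i => ?_⟩
  fin_cases i <;> fin_cases j <;> simp

theorem IsWindow.mul_simpleLift {M : Matrix (Fin 3) (Fin 3) R} {f : Fin 3 → ℤ}
    (h : IsWindow M f) (s : Fin 3) : IsWindow (M * simpleLiftMatrix s) (windowStep f s) := by
  have neg : ∀ {g : Fin 3 → R} {a m : ℤ},
      (∃ c : ℂ, c ≠ 0 ∧ ∀ i : Fin 3, g i = if ((i : ℕ) : ℤ) = a then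
        LaurentPolynomial.C c * LaurentPolynomial.T m else 0) →
      ∃ c : ℂ, c ≠ 0 ∧ ∀ i : Fin 3, - g i = if ((i : ℕ) : ℤ) = a then
        LaurentPolynomial.C c * LaurentPolynomial.T m else 0 := by
    rintro g a m ⟨c, hc, e⟩
    refine ⟨-c, neg_ne_zero.2 hc, fun i => ?_⟩
    rw [e i]
    split_ifs <;> simp
  have shift : ∀ {g : Fin 3 → R} {a m : ℤ} (l : ℤ),
      (∃ c : ℂ, c ≠ 0 ∧ ∀ i : Fin 3, g i = if ((i : ℕ) : ℤ) = a then
        LaurentPolynomial.C c * LaurentPolynomial.T m else 0) →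
      ∃ c : ℂ, c ≠ 0 ∧ ∀ i : Fin 3, g i * LaurentPolynomial.T l = if ((i : ℕ) : ℤ) = a then
        LaurentPolynomial.C c * LaurentPolynomial.T (m + l) else 0 := by
    rintro g a m l ⟨c, hc, e⟩
    refine ⟨c, hc, fun i => ?_⟩
    rw [e i, LaurentPolynomial.T_add]
    split_ifs <;> ring
  fin_cases s <;> intro j <;> fin_cases j <;>
    simp only [simpleLiftMatrix, windowStep, mul_apply, Fin.sum_univ_three] <;> simp
  · have e2 : -((f 2 - 3) / 3) = -(f 2 / 3) + 1 := by omega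
    rw [e2]
    exact neg (shift 1 (h 2))
  · exact h 1
  · have e2 : -((f 0 + 3) / 3) = -(f 0 / 3) + -1 := by omega
    rw [e2]
    exact shift (-1) (h 0)
  · exact neg (h 1)
  · exact h 0
  · exact h 2
  · exact h 0
  · exact neg (h 2)
  · exact h 1

/-- The lift to `N(ℂ[t, t⁻¹])` of a word in the simple reflections. -/
noncomputable def wordLift (ω : List (Fin 3)) : normT :=
  (ω.map fun i => (⟨simpleLift i, simpleLift_mem i⟩ : normT)).prod

theorem mk_wordLift (ω : List (Fin 3)) :
    (QuotientGroup.mk (wordLift ω) : AffineWeyl) = (ω.map simpleRefl).prod := by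
  have := map_list_prod (QuotientGroup.mk' (constTorus.subgroupOf normT))
    (ω.map fun i => (⟨simpleLift i, simpleLift_mem i⟩ : normT))
  rw [List.map_map] at this
  exact this

/-- The window of a word in the simple reflections. -/
def wordWindow (ω : List (Fin 3)) : Fin 3 → ℤ := ω.foldl windowStep ![0, 1, 2]

theorem isWindow_wordLift (ω : List (Fin 3)) : IsWindow (wordLift ω).1.1 (wordWindow ω) := by
  induction ω using List.reverseRecOn with
  | nil => exact isWindow_one
  | append_singleton ω s ih =>
    have e : wordLift (ω ++ [s]) = wordLift ω * ⟨simpleLift s, simpleLift_mem s⟩ := by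
      simp [wordLift]
    rw [e, wordWindow, List.foldl_append]
    exact ih.mul_simpleLift s

theorem windowRegular_wordWindow (ω : List (Fin 3)) : WindowRegular (wordWindow ω) := by
  induction ω using List.reverseRecOn with
  | nil => exact ⟨by decide, by decide, by decide⟩
  | append_singleton ω s ih =>
    rw [wordWindow, List.foldl_append]
    exact ih.windowStep s

theorem windowLength_wordWindow_le (ω : List (Fin 3)) :
    windowLength (wordWindow ω) ≤ ω.length := by
  induction ω using List.reverseRecOn with
  | nil => simp [wordWindow, windowLength]
  | append_singleton ω s ih =>
    rw [wordWindow, List.foldl_append, List.length_append]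
    exact (windowLength_windowStep_le (windowRegular_wordWindow ω) s).trans
      (Nat.add_le_add_right ih 1)

/-- The window depends only on the class modulo `T`, so it may be computed from a shortest word,
along which `windowLength` grows by at most 1 per letter. -/
theorem windowLength_le_length (ω : List (Fin 3)) :
    windowLength (wordWindow ω) ≤ length (QuotientGroup.mk (wordLift ω)) := by
  obtain ⟨ω', h1, h2⟩ := Nat.sInf_mem (s := {k | ∃ ω' : List (Fin 3), ω'.length = k ∧
    (ω'.map simpleRefl).prod = (QuotientGroup.mk (wordLift ω) : AffineWeyl)})
    ⟨_, ω, rfl, (mk_wordLift ω).symm⟩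
  change ω'.length = length _ at h1
  rw [← h1]
  refine le_trans (le_of_eq ?_) (windowLength_wordWindow_le ω')
  rw [← mk_wordLift, QuotientGroup.eq, Subgroup.mem_subgroupOf] at h2
  have h3 := (isWindow_wordLift ω').mul_torus h2
  have e : (wordLift ω').1.1 * ((wordLift ω')⁻¹ * wordLift ω : normT).1.1 =
      (wordLift ω).1.1 :=
    congrArg (fun x : normT => x.1.1) (mul_inv_cancel_left (wordLift ω') (wordLift ω))
  rw [e] at h3
  rw [h3.unique (isWindow_wordLift ω)]

/-! ### Recognizing Bruhat cells from explicit factorizations -/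

/-- `M` is a monomial matrix over `F` of the same shape as in `IsWindow`. -/
def IsLoopWindow (M : Matrix (Fin 3) (Fin 3) F) (f : Fin 3 → ℤ) : Prop :=
  ∀ j, ∃ a, HasOrder (-(f j / 3)) a ∧ ∀ i : Fin 3, M i j = if ((i : ℕ) : ℤ) = f j % 3 then a else 0

theorem polyToSeries_C_mul_T (c : ℂ) (m : ℤ) :
    polyToSeries (LaurentPolynomial.C c * LaurentPolynomial.T m) = HahnSeries.single m c := by
  rw [polyToSeries, LaurentPolynomial.eval₂_C_mul_T, Units.val_zpow_eq_zpow_val, Units.val_mk0,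
    constF, HahnSeries.C_mul_eq_smul, ← RatFunc.single_zpow]
  ext n
  simp [HahnSeries.coeff_single]

/-- Entrywise description of the matrices in `𝓑`. -/
def IsIwahoriMatrix (M : Matrix (Fin 3) (Fin 3) F) : Prop :=
  (∀ i j, VanishBelow 0 (M i j)) ∧ ∀ i j, j < i → (M i j).coeff 0 = 0

/-- A monomial matrix over `F` with the right window differs from the chosen lift only by a diagonal
matrix of units of `A`, which is absorbed into the right Iwahori factor. -/
theorem mem_bruhatCell_wordLift {x : LoopG} {b y r : Matrix (Fin 3) (Fin 3) F} (ω : List (Fin 3))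
    (hx : x.1 = b * y * r) (hb : b.det = 1) (hr : r.det = 1) (hb' : IsIwahoriMatrix b)
    (hr' : IsIwahoriMatrix r) (hy : IsLoopWindow y (wordWindow ω)) :
    x ∈ bruhatCell (QuotientGroup.mk (wordLift ω)) := by
  have hydet : y.det = 1 := by
    have := congrArg det hx
    rwa [x.2, det_mul, det_mul, hb, hr, one_mul, mul_one, eq_comm] at this
  set n : LoopG := SpecialLinearGroup.map polyToSeries (wordLift ω).1 with hn
  have hyn : ∃ u : Fin 3 → F, (∀ j, HasOrder 0 (u j)) ∧ y = n.1 * diagonal u := by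
    choose c hc e using isWindow_wordLift ω
    choose a ha e' using hy
    refine ⟨fun j => a j / HahnSeries.single (-(wordWindow ω j / 3)) (c j), fun j => ?_, ?_⟩
    · simpa using (ha j).div (hasOrder_single (-(wordWindow ω j / 3)) (hc j))
    · ext i j : 1
      have h1 : n.1 i j = polyToSeries ((wordLift ω).1.1 i j) := rfl
      rw [mul_diagonal, h1, e, e']
      split_ifs
      · rw [polyToSeries_C_mul_T, mul_div_cancel₀ _ (hasOrder_single _ (hc j)).ne_zero]
      · rw [map_zero, zero_mul]
  obtain ⟨u, hu, e⟩ := hyn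
  have hu1 : (diagonal u).det = 1 := by
    rw [e, det_mul, n.2, one_mul] at hydet
    exact hydet
  refine ⟨wordLift ω, rfl, ⟨b, hb⟩, mem_iwahori_iff.2 hb', ⟨diagonal u, hu1⟩ * ⟨r, hr⟩,
    mul_mem (mem_iwahori_iff.2 ⟨fun i j => ?_, fun i j hij => ?_⟩) ((mem_iwahori_iff (x := ⟨r, hr⟩)).2 hr'), ?_⟩
  · by_cases hij : i = j
    · subst hij
      simpa using (hu i).1
    · simpa [diagonal_apply_ne _ hij] using VanishBelow.zero
  · simp [diagonal_apply_ne _ hij.ne']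
  · refine Subtype.ext ?_
    change x.1 = b * n.1 * (diagonal u * r)
    rw [hx, e]
    simp only [Matrix.mul_assoc]

/-! ### Points of the image in cells of length greater than 6 -/

/-- A lift of the longest element of the finite Weyl group. -/
def longestLift : G := ⟨!![0, 0, 1; 0, -1, 0; 1, 0, 0], by simp [det_fin_three]⟩

theorem constLoop_longestLift_mul_evalLoop (p : Polynomial F) (hp : p.coeff 0 = 1) (x y z : ℂ) :
    (constLoop longestLift * evalLoop p hp (nilradicalMk x y z)).1 =
      !![0, 0, 1; 0, -1, -(constF y * p.coeff 1); 1, constF x * p.coeff 1,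
        constF z * p.coeff 1 + constF (x * y) * p.coeff 2] := by
  have e : longestLift.1.map constF = !![0, 0, 1; 0, -1, 0; 1, 0, 0] := by
    ext i j : 1
    fin_cases i <;> fin_cases j <;> simp [longestLift]
  change longestLift.1.map constF * (evalLoop p hp (nilradicalMk x y z)).1 = _
  rw [evalLoop_nilradicalMk, e]
  generalize constF x * p.coeff 1 = u, constF y * p.coeff 1 = v,
    constF z * p.coeff 1 + constF (x * y) * p.coeff 2 = w
  ext i j : 1
  fin_cases i <;> fin_cases j <;> simp [Matrix.mul_apply, Fin.sum_univ_three]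
  ring

theorem isIwahoriMatrix_of {m : Fin 3 → Fin 3 → F} (h : ∀ i j, i ≤ j → VanishBelow 0 (m i j))
    (h' : ∀ i j, j < i → VanishBelow 1 (m i j)) : IsIwahoriMatrix (of m) := by
  refine ⟨fun i j => ?_, fun i j hij => h' i j hij 0 one_pos⟩
  rcases le_or_gt i j with hij | hij
  · exact h i j hij
  · exact (h' i j hij).mono zero_le_one

theorem isIwahoriMatrix_upper {x y z : F} (hx : VanishBelow 0 x) (hy : VanishBelow 0 y)
    (hz : VanishBelow 0 z) : IsIwahoriMatrix !![1, x, z; 0, 1, y; 0, 0, 1] := by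
  refine isIwahoriMatrix_of (fun i j h => ?_) (fun i j h => ?_) <;>
    fin_cases i <;> fin_cases j <;> first
      | exact absurd h (by decide)
      | simp [VanishBelow.one, VanishBelow.zero, hx, hy, hz]

theorem isLoopWindow_of {y : Matrix (Fin 3) (Fin 3) F} {f : Fin 3 → ℤ} (r : Fin 3 → Fin 3)
    (hr : ∀ j, f j % 3 = (r j : ℕ)) (h0 : ∀ i j, i ≠ r j → y i j = 0)
    (h : ∀ j, HasOrder (-(f j / 3)) (y (r j) j)) : IsLoopWindow y f := by
  refine fun j => ⟨_, h j, fun i => ?_⟩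
  split_ifs with hi
  · rw [hr j] at hi
    rw [Fin.ext (Nat.cast_injective hi)]
  · refine h0 i j fun e => hi ?_
    rw [hr j, e]

/-- A word for the translation `diag (t ^ m, 1, t ^ (-m))`. -/
def translationWord (m : ℕ) : List (Fin 3) := (List.replicate m [1, 2, 1, 0]).flatten

theorem wordWindow_translationWord (m : ℕ) :
    wordWindow (translationWord m) = ![-3 * (m : ℤ), 1, 3 * m + 2] := by
  induction m with
  | zero => simp [wordWindow, translationWord]
  | succ m ih =>
    have e : translationWord (m + 1) = translationWord m ++ [1, 2, 1, 0] := by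
      simp [translationWord, List.replicate_succ']
    rw [e, wordWindow, List.foldl_append, ← wordWindow, ih]
    ext j
    fin_cases j <;> simp [windowStep] <;> ring

/-- Elimination from the lower right corner has pivots `c`, `-d/c`, `-d⁻¹`. The pole of order `m` in
`c` and `d` exceeds those of `a` and `a'`, so the lower triangular factor is congruent to 1 modulo
`t`. The inversion count of the window is `4m`. -/
theorem exists_bruhatCell_translation {x : LoopG} {a a' c : F} {m : ℕ} (hm : 2 ≤ m)
    (hx : x.1 = !![0, 0, 1; 0, -1, -a'; 1, a, c]) (hc : HasOrder (-m) c)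
    (hd : HasOrder (-m) (c - a * a')) (ha : VanishBelow (1 - m) a)
    (ha' : VanishBelow (1 - m) a') : ∃ w, x ∈ bruhatCell w ∧ 6 < length w := by
  set d := c - a * a' with hd'
  have hc0 := hc.ne_zero
  have hd0 := hd.ne_zero
  have h1 : VanishBelow 1 (a / c) := by simpa using ha.div hc
  have h2 : VanishBelow 1 (a' / c) := by simpa using ha'.div hc
  have h3 : VanishBelow 1 (a / d) := by simpa using ha.div hd
  have h4 : VanishBelow 1 (a' / d) := by simpa using ha'.div hd
  have h5 : VanishBelow 1 c⁻¹ := hc.inv.1.mono (by omega)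
  have h6 : HasOrder m d⁻¹ := by simpa using hd.inv
  have h7 : HasOrder 0 (d / c) := by simpa using hd.div hc
  refine ⟨_, mem_bruhatCell_wordLift (b := !![1, a / d, c⁻¹; 0, 1, -(a' / c); 0, 0, 1])
    (y := !![-d⁻¹, 0, 0; 0, -(d / c), 0; 0, 0, c])
    (r := !![1, 0, 0; -(a' / d), 1, 0; c⁻¹, a / c, 1]) (translationWord m)
    ?_ ?_ ?_ ?_ ?_ ?_, ?_⟩
  · have e : c = d + a * a' := by rw [hd']; ring
    rw [hx]
    clear_value d
    ext i j : 1
    fin_cases i <;> fin_cases j <;> simp [Matrix.mul_apply, Fin.sum_univ_three] <;>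
      field_simp <;> (try rw [e]) <;> ring
  · simp [det_fin_three]
  · simp [det_fin_three]
  · exact isIwahoriMatrix_upper (h3.mono (by norm_num)) (h2.neg.mono (by norm_num))
      (h5.mono (by norm_num))
  · refine isIwahoriMatrix_of (fun i j h => ?_) (fun i j h => ?_) <;>
      fin_cases i <;> fin_cases j <;> first
        | exact absurd h (by decide)
        | simp [VanishBelow.one, VanishBelow.zero, h1, h4.neg, h5]
  · rw [wordWindow_translationWord]
    refine isLoopWindow_of id (fun j => ?_) (fun i j h => ?_) (fun j => ?_)
    · fin_cases j <;> simp
    · fin_cases i <;> fin_cases j <;> first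
        | rfl
        | exact absurd rfl h
    · fin_cases j
      · have : -(-(3 * (m : ℤ)) / 3) = m := by omega
        simpa [this] using h6.neg
      · simpa using h7.neg
      · have : -((3 * (m : ℤ) + 2) / 3) = -m := by omega
        simpa [this] using hc
  · refine lt_of_lt_of_le ?_ (windowLength_le_length _)
    rw [wordWindow_translationWord]
    simp [windowLength]
    omega

/-- With `c` regular, the pivots in the lower right 2×2 block are the off-diagonal entries `a` and
`-a`, which gives a window with 7 inversions. -/
theorem exists_bruhatCell_of_corner_regular {x : LoopG} {a c : F}
    (hx : x.1 = !![0, 0, 1; 0, -1, -a; 1, a, c]) (ha : HasOrder (-1) a) (hc : VanishBelow 0 c) :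
    ∃ w, x ∈ bruhatCell w ∧ 6 < length w := by
  set d := a * a - c with hd'
  have ha2 : HasOrder (-2) (a * a) := ha.mul ha
  have hd : HasOrder (-2) d := by
    rw [hd', sub_eq_neg_add]
    exact ha2.add_left (hc.neg.mono (by norm_num))
  have ha0 := ha.ne_zero
  have hd0 := hd.ne_zero
  have h1 : VanishBelow 1 (a / d) := by simpa using (ha.div hd).1
  have h2 : VanishBelow 2 d⁻¹ := by simpa using hd.inv.1
  have h3 : VanishBelow 1 a⁻¹ := by simpa using ha.inv.1
  have h4 : VanishBelow 1 (c / a) := by simpa using hc.div ha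
  have h5 : HasOrder 2 (a * a)⁻¹ := by simpa using ha2.inv
  have h6 : VanishBelow 0 (a * a / d) := by simpa using (ha2.div hd).1
  have hw : wordWindow [1, 2, 1, 0, 1, 2, 0] = ![-6, 5, 4] := by decide
  refine ⟨_, mem_bruhatCell_wordLift (b := !![1, -(a / d), -d⁻¹; 0, 1, 0; 0, 0, 1])
    (y := !![(a * a)⁻¹, 0, 0; 0, 0, -a; 0, a, 0])
    -- This factor is not unipotent: its corner `a²/d` is a unit of `A`, since both terms have order
    -- -2.
    (r := !![a * a / d, 0, 0; a⁻¹, 1, c / a; 0, a⁻¹, 1]) [1, 2, 1, 0, 1, 2, 0]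
    ?_ ?_ ?_ ?_ ?_ ?_, ?_⟩
  · have e : c = a * a - d := by rw [hd']; ring
    rw [hx]
    clear_value d
    ext i j : 1
    fin_cases i <;> fin_cases j <;> simp [Matrix.mul_apply, Fin.sum_univ_three] <;>
      field_simp <;> (try rw [e]) <;> ring
  · simp [det_fin_three]
  · have e : c = a * a - d := by rw [hd']; ring
    clear_value d
    simp [det_fin_three]
    field_simp
    rw [e]
    ring
  · exact isIwahoriMatrix_upper (h1.neg.mono (by norm_num)) VanishBelow.zero
      (h2.neg.mono (by norm_num))
  · refine isIwahoriMatrix_of (fun i j h => ?_) (fun i j h => ?_) <;>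
      fin_cases i <;> fin_cases j <;> first
        | exact absurd h (by decide)
        | simp [VanishBelow.one, VanishBelow.zero, h3, h4.mono zero_le_one, h6]
  · rw [hw]
    refine isLoopWindow_of ![0, 2, 1] (by decide) (fun i j h => ?_) (fun j => ?_)
    · fin_cases i <;> fin_cases j <;> first
        | rfl
        | exact absurd rfl h
    · fin_cases j
      · exact h5
      · exact ha
      · exact ha.neg
  · refine lt_of_lt_of_le ?_ (windowLength_le_length _)
    rw [hw]
    decide

/-- Here `c = a² - d` has order -2 and is the first pivot. The remaining 2×2 block has diagonal
entries `-c⁻¹`, `d/c` of order at least 2 and off-diagonal entries `∓a/c` of order 1, so the next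
pivots are off the diagonal; again there are 7 inversions. -/
theorem exists_bruhatCell_of_minor_regular {x : LoopG} {a c : F}
    (hx : x.1 = !![0, 0, 1; 0, -1, -a; 1, a, c]) (ha : HasOrder (-1) a)
    (hd : VanishBelow 0 (a * a - c)) : ∃ w, x ∈ bruhatCell w ∧ 6 < length w := by
  set d := a * a - c with hd'
  have e : c = a * a - d := by rw [hd']; ring
  have ha2 : HasOrder (-2) (a * a) := ha.mul ha
  have hc : HasOrder (-2) c := by
    rw [e, sub_eq_neg_add]
    exact ha2.add_left (hd.neg.mono (by norm_num))
  have ha0 := ha.ne_zero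
  have hc0 := hc.ne_zero
  have h1 : HasOrder 1 (a / c) := by simpa using ha.div hc
  have h2 : VanishBelow 2 c⁻¹ := by simpa using hc.inv.1
  have h3 : HasOrder 1 a⁻¹ := by simpa using ha.inv
  have h4 : VanishBelow 1 (d / a) := by simpa using hd.div ha
  have hw : wordWindow [1, 2, 1, 0, 2, 1, 0] = ![-2, -3, 8] := by decide
  refine ⟨_, mem_bruhatCell_wordLift (b := !![1, -a⁻¹, c⁻¹; 0, 1, -(a / c); 0, 0, 1])
    (y := !![0, -a⁻¹, 0; a / c, 0, 0; 0, 0, c])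
    (r := !![1, d / a, 0; 0, 1, 0; c⁻¹, a / c, 1]) [1, 2, 1, 0, 2, 1, 0]
    ?_ ?_ ?_ ?_ ?_ ?_, ?_⟩
  · have e' : d = a * a - c := hd'
    rw [hx]
    clear_value d
    ext i j : 1
    fin_cases i <;> fin_cases j <;> simp [Matrix.mul_apply, Fin.sum_univ_three] <;>
      field_simp <;> (try rw [e']) <;> ring
  · simp [det_fin_three]
  · simp [det_fin_three]
  · exact isIwahoriMatrix_upper (h3.1.neg.mono (by norm_num)) (h1.1.neg.mono (by norm_num))
      (h2.mono (by norm_num))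
  · refine isIwahoriMatrix_of (fun i j h => ?_) (fun i j h => ?_) <;>
      fin_cases i <;> fin_cases j <;> first
        | exact absurd h (by decide)
        | simp [VanishBelow.one, VanishBelow.zero, h1.1, h2.mono one_le_two, h4.mono zero_le_one]
  · rw [hw]
    refine isLoopWindow_of ![1, 0, 2] (by decide) (fun i j h => ?_) (fun j => ?_)
    · fin_cases i <;> fin_cases j <;> first
        | rfl
        | exact absurd rfl h
    · fin_cases j
      · exact h1
      · exact h3.neg
      · exact hc
  · refine lt_of_lt_of_le ?_ (windowLength_le_length _)
    rw [hw]
    decide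

/-- Subtracting a multiple of a series with a simple pole removes a simple pole. -/
theorem exists_vanishBelow_constF_mul_add {a x : F} (ha : HasOrder (-1) a)
    (hx : VanishBelow (-1) x) : ∃ z : ℂ, VanishBelow 0 (constF z * a + x) := by
  refine ⟨-x.coeff (-1) / a.coeff (-1), fun n hn => ?_⟩
  rw [HahnSeries.coeff_add, coeff_constF_mul]
  rcases lt_or_eq_of_le (show n ≤ -1 by omega) with h | rfl
  · rw [ha.1 n h, hx n h, mul_zero, add_zero]
  · rw [div_mul_cancel₀ _ ha.2, neg_add_cancel]

theorem exists_longestLift_mul_mem_bruhatCell (p : Polynomial F) (hp : p.coeff 0 = 1) {k : ℤ}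
    (hk : k < 0) (ha : HasOrder k (p.coeff 1)) :
    ∃ Y w, constLoop longestLift * evalLoop p hp Y ∈ bruhatCell w ∧ 6 < length w := by
  have hmul := constLoop_longestLift_mul_evalLoop p hp
  set a := p.coeff 1
  set b := p.coeff 2
  rcases lt_or_eq_of_le (show k ≤ -1 by omega) with hk1 | rfl
  · obtain ⟨m, rfl⟩ : ∃ m : ℕ, k = -m := ⟨k.natAbs, by omega⟩
    -- With `Y = E₁₃` the middle entries vanish, and both the corner and the minor reduce to the
    -- linear coefficient of `p`, of order `-m` with `m ≥ 2`.
    refine ⟨_, exists_bruhatCell_translation (m := m) (by omega) (hmul 0 0 1) ?_ ?_ ?_ ?_⟩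
    · simpa using ha
    · simpa using ha
    · simpa using VanishBelow.zero
    · simpa using VanishBelow.zero
  have h11 : ∀ z, (constLoop longestLift * evalLoop p hp (nilradicalMk 1 1 z)).1 =
      !![0, 0, 1; 0, -1, -a; 1, a, constF z * a + b] := fun z => by simpa using hmul 1 1 z
  rcases vanishBelow_or_hasOrder b (-1) with hb | ⟨n, hn, hb⟩
  · obtain ⟨z, hz⟩ := exists_vanishBelow_constF_mul_add ha hb
    exact ⟨_, exists_bruhatCell_of_corner_regular (h11 z) ha hz⟩
  rcases vanishBelow_or_hasOrder (a * a - b) (-1) with hd | ⟨l, hl, hd⟩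
  · obtain ⟨z, hz⟩ := exists_vanishBelow_constF_mul_add ha hd
    refine ⟨_, exists_bruhatCell_of_minor_regular (h11 (-z)) ha ?_⟩
    rw [map_neg]
    convert hz using 1
    ring
  · have ha2 : HasOrder (-2) (a * a) := ha.mul ha
    -- If `b` has a pole of order above 2, it dominates `a²`. If the order is 2, then `a² - b` has
    -- at most a double pole, and `hl` makes it exactly double.
    have hln : l = n := by
      rcases lt_or_eq_of_le (show n ≤ -2 by omega) with h | rfl
      · refine hd.unique ?_
        rw [sub_eq_add_neg]
        exact hb.neg.add_left (ha2.1.mono (by omega))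
      · by_contra h
        exact hd.2 (ha2.1.sub hb.1 l (by omega))
    subst hln
    obtain ⟨m, rfl⟩ : ∃ m : ℕ, l = -m := ⟨l.natAbs, by omega⟩
    have h0 : constF 0 * a + b = b := by simp
    refine ⟨_, exists_bruhatCell_translation (m := m) (by omega) (h11 0) ?_ ?_
      (ha.1.mono (by omega)) (ha.1.mono (by omega))⟩
    · rwa [h0]
    · rw [h0, ← neg_sub]
      exact hd.neg

end AffineFlagSL3

theorem mainTheorem3 (p : Polynomial AffineFlagSL3.F) (hp : p.coeff 0 = 1) :
    (Function.Injective (AffineFlagSL3.psi p hp) →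
      ∃ (g : AffineFlagSL3.G) (w : AffineFlagSL3.AffineWeyl) (Y : AffineFlagSL3.nilradical),
        AffineFlagSL3.psi p hp (AffineFlagSL3.Cotangent.mk g Y) ∈
            AffineFlagSL3.toFlag '' AffineFlagSL3.bruhatCell w ∧
          6 < AffineFlagSL3.length w) ∧
    ∀ w : AffineFlagSL3.AffineWeyl, ¬ AffineFlagSL3.RealizesCompactification p hp w := by
  refine ⟨fun hi => ?_, AffineFlagSL3.not_realizesCompactification p hp⟩
  obtain ⟨k, hk, ha⟩ := AffineFlagSL3.exists_hasOrder_of_injective p hp hi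
  obtain ⟨Y, w, hY, hw⟩ := AffineFlagSL3.exists_longestLift_mul_mem_bruhatCell p hp hk ha
  exact ⟨_, w, Y, ⟨_, hY, rfl⟩, hw⟩
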